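/- For complex $a,b,c$ with $c\notin\{0,-1,-2,\dots\}$ let ${}_2F_1(a,b;c;\cdot)$ denote the analytic continuation to $\mathbb{C}\setminus[1,\infty)$ of the function $z\mapsto\sum_{k\ge 0}\frac{(a)_k(b)_k}{(c)_k\,k!}z^k$, $|z|<1$. Let $x\in\mathbb{R}$ with $x<1$, and let $a,b,c,\mu\in\mathbb{C}$ satisfy $\operatorname{Re}\mu>0$, $\operatorname{Re}a>\operatorname{Re}\mu$, $\operatorname{Re}b>\operatorname{Re}\mu$, with neither $c$ nor $c-\mu$ in $\{0,-1,-2,\dots\}$. Then the Weyl fractional integral below converges absolutely and $$\int_{-\infty}^{x}{}_2F_1(a,b;c;y)\,\frac{(x-y)^{\mu-1}}{\Gamma(\mu)}\,dy=\frac{\Gamma(a-\mu)}{\Gamma(a)}\,\frac{\Gamma(b-\mu)}{\Gamma(b)}\,\frac{\Gamma(c)}{\Gamma(c-\mu)}\;{}_2F_1(a-\mu,b-\mu;c-\mu;x).$$ -/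

import Mathlib

/-- The cut plane `ℂ \ [1, ∞)`. -/
def hypergeometricDomain : Set ℂ := {z : ℂ | z.im = 0 → z.re < 1}

theorem mem_hypergeometricDomain_iff {z : ℂ} :
    z ∈ hypergeometricDomain ↔ 1 - z ∈ Complex.slitPlane := by
  simp only [hypergeometricDomain, Set.mem_ofPred_eq, Complex.mem_slitPlane_iff, Complex.sub_re,
    Complex.one_re, Complex.sub_im, Complex.one_im, zero_sub, neg_ne_zero, sub_pos]
  tauto

theorem isOpen_hypergeometricDomain : IsOpen hypergeometricDomain := by
  have h : hypergeometricDomain = (fun z : ℂ => 1 - z) ⁻¹' Complex.slitPlane := by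
    ext z
    exact mem_hypergeometricDomain_iff
  rw [h]
  exact Complex.isOpen_slitPlane.preimage (by fun_prop)

theorem one_sub_mul_mem_slitPlane {z : ℂ} (hz : z ∈ hypergeometricDomain) {t : ℝ}
    (ht : t ∈ Set.Icc (0 : ℝ) 1) : 1 - z * (t : ℂ) ∈ Complex.slitPlane := by
  rw [Complex.mem_slitPlane_iff]
  simp only [Complex.sub_re, Complex.one_re, Complex.mul_re, Complex.ofReal_re, Complex.ofReal_im,
    Complex.sub_im, Complex.one_im, Complex.mul_im]
  by_cases h : z.im = 0
  · left
    have h1 := hz h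
    rw [h]
    have h2 : z.re * t < 1 := by
      rcases eq_or_lt_of_le ht.1 with h0 | h0
      · simp [← h0]
      · nlinarith [ht.2]
    linarith
  · rcases eq_or_lt_of_le ht.1 with h0 | h0
    · left
      simp [← h0]
    · right
      have : z.im * t ≠ 0 := mul_ne_zero h h0.ne'
      simpa using this

theorem ball_subset_hypergeometricDomain : Metric.ball (0 : ℂ) 1 ⊆ hypergeometricDomain := by
  intro z hz _
  have h : ‖z‖ < 1 := by simpa using hz
  exact lt_of_le_of_lt (Complex.re_le_norm z) h

theorem hasSum_regularizedGaussHGFun (a b c : ℂ) {z : ℂ} (hz : z ∈ Metric.ball (0 : ℂ) 1) :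
    HasSum (fun n : ℕ => (ascPochhammer ℂ n).eval a * (ascPochhammer ℂ n).eval b
      / (n.factorial * Complex.Gamma (c + n)) * z ^ n) (Complex.regularizedGaussHGFun a b c z) := by
  have hr := Complex.radius_regularizedGaussHGFunSeries_ge_one a b c
  have hb : z ∈ Metric.eball (0 : ℂ) (Complex.regularizedGaussHGFunSeries a b c).radius := by
    refine Metric.eball_subset_eball hr ?_
    rw [← ENNReal.ofReal_one, Metric.eball_ofReal]
    exact hz
  have h := (Complex.regularizedGaussHGFunSeries a b c).hasSum hb
  simpa [Complex.regularizedGaussHGFunSeries, Complex.regularizedHGFunSeries,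
    FormalMultilinearSeries.ofScalars_apply_eq, Complex.regularizedHGFunCoeff,
    Complex.regularizedGaussHGFun, mul_comm] using h

/-- The Euler integral is holomorphic on the cut plane. -/
theorem differentiableOn_euler {a b c : ℂ} (hb : 0 < b.re) (hcb : b.re < c.re) :
    DifferentiableOn ℂ (fun z : ℂ => ∫ t : ℝ in (0 : ℝ)..1,
      ((t : ℂ) ^ (b - 1) * (1 - (t : ℂ)) ^ (c - b - 1)) * (1 - z * (t : ℂ)) ^ (-a))
      hypergeometricDomain := by
  intro z₀ hz₀
  apply DifferentiableAt.differentiableWithinAt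
  have hconv : IntervalIntegrable (fun t : ℝ =>
      (t : ℂ) ^ (b - 1) * (1 - (t : ℂ)) ^ (c - b - 1)) MeasureTheory.volume 0 1 :=
    Complex.betaIntegral_convergent hb (by simpa using hcb)
  obtain ⟨r, hr, hrU⟩ := Metric.nhds_basis_closedBall.mem_iff.1
    (isOpen_hypergeometricDomain.mem_nhds hz₀)
  have hcont : ∀ e : ℂ, ContinuousOn (fun p : ℂ × ℝ => (1 - p.1 * (p.2 : ℂ)) ^ e)
      (Metric.closedBall z₀ r ×ˢ Set.Icc (0 : ℝ) 1) := by
    intro e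
    refine ContinuousOn.cpow (by fun_prop) (by fun_prop) ?_
    rintro ⟨z, t⟩ ⟨h1, h2⟩
    exact one_sub_mul_mem_slitPlane (hrU h1) h2
  have hcont1 : ∀ e : ℂ, ∀ z ∈ Metric.closedBall z₀ r,
      ContinuousOn (fun t : ℝ => (1 - z * (t : ℂ)) ^ e) (Set.uIcc (0 : ℝ) 1) := by
    intro e z hz
    rw [Set.uIcc_of_le zero_le_one]
    exact (hcont e).comp (f := fun t : ℝ => (z, t)) (by fun_prop) (fun t ht => ⟨hz, ht⟩)
  obtain ⟨C, hC⟩ := ((isCompact_closedBall z₀ r).prod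
    (isCompact_Icc (a := (0 : ℝ)) (b := 1))).exists_bound_of_continuousOn (hcont (-a - 1))
  have hmeas := fun (e : ℂ) (z : ℂ) (hz : z ∈ Metric.closedBall z₀ r) =>
    hconv.mul_continuousOn (hcont1 e z hz)
  refine (intervalIntegral.hasDerivAt_integral_of_dominated_loc_of_deriv_le
    (μ := MeasureTheory.volume) (s := Metric.ball z₀ r)
    (F' := fun z t => ((t : ℂ) ^ (b - 1) * (1 - (t : ℂ)) ^ (c - b - 1)) *
      (1 - z * (t : ℂ)) ^ (-a - 1) * (a * t))
    (bound := fun t => ‖(t : ℂ) ^ (b - 1) * (1 - (t : ℂ)) ^ (c - b - 1)‖ * (C * ‖a‖))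
    (Metric.ball_mem_nhds _ hr) ?_ ?_ ?_ ?_ ?_ ?_).2.differentiableAt
  · filter_upwards [Metric.ball_mem_nhds z₀ hr] with z hz
    exact ((hmeas (-a) z (Metric.ball_subset_closedBall hz)).def').aestronglyMeasurable
  · exact hmeas (-a) z₀ (Metric.mem_closedBall_self hr.le)
  · exact (((hmeas (-a - 1) z₀ (Metric.mem_closedBall_self hr.le)).mul_continuousOn
      (g := fun t : ℝ => a * (t : ℂ)) (by fun_prop)).def').aestronglyMeasurable
  · refine Filter.Eventually.of_forall fun t ht z hz => ?_
    rw [Set.uIoc_of_le zero_le_one] at ht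
    have h1 := hC (z, t) ⟨Metric.ball_subset_closedBall hz, ht.1.le, ht.2⟩
    have h2 : ‖(t : ℂ)‖ ≤ 1 := by
      rw [Complex.norm_real, Real.norm_of_nonneg ht.1.le]; exact ht.2
    rw [norm_mul, norm_mul _ ((1 - z * (t : ℂ)) ^ (-a - 1)), mul_assoc, norm_mul a]
    have h3 : ‖a‖ * ‖(t : ℂ)‖ ≤ ‖a‖ := mul_le_of_le_one_right (norm_nonneg _) h2
    have : (0 : ℝ) ≤ C := (norm_nonneg _).trans h1
    gcongr
  · exact hconv.norm.mul_const _
  · refine Filter.Eventually.of_forall fun t ht z hz => ?_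
    rw [Set.uIoc_of_le zero_le_one] at ht
    have hs := one_sub_mul_mem_slitPlane (hrU (Metric.ball_subset_closedBall hz))
      (t := t) ⟨ht.1.le, ht.2⟩
    have h1 : HasDerivAt (fun z : ℂ => 1 - z * (t : ℂ)) (-(t : ℂ)) z := by
      simpa using ((hasDerivAt_id z).mul_const (t : ℂ)).const_sub 1
    have h2 := (h1.cpow_const (c := -a) hs).const_mul
      ((t : ℂ) ^ (b - 1) * (1 - (t : ℂ)) ^ (c - b - 1))
    exact h2.congr_deriv (by ring)

theorem hasSum_congr_fun {f g : ℕ → ℂ} {S : ℂ} (h : HasSum f S) (hfg : ∀ n, f n = g n) :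
    HasSum g S := by
  rwa [funext hfg] at h

theorem hasSum_one_sub_cpow (a : ℂ) {w : ℂ} (hw : ‖w‖ < 1) :
    HasSum (fun n : ℕ => (ascPochhammer ℂ n).eval a / n.factorial * w ^ n)
      ((1 - w) ^ (-a)) := by
  have h := (Complex.one_div_one_sub_cpow_hasFPowerSeriesOnBall_zero a).hasSum (y := w) (by
    rw [← ENNReal.ofReal_one, Metric.eball_ofReal]; simpa using hw)
  simp only [zero_add, one_div, ← Complex.cpow_neg] at h
  refine hasSum_congr_fun h fun n => ?_
  rw [FormalMultilinearSeries.ofScalars_apply_eq, smul_eq_mul]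
  congr 1
  have h2 := Ring.factorial_nsmul_multichoose_eq_ascPochhammer a n
  rw [Polynomial.ascPochhammer_smeval_eq_eval, nsmul_eq_mul] at h2
  rw [← h2, mul_div_cancel_left₀ _ (by exact_mod_cast n.factorial_ne_zero), Ring.choose]
  congr 1
  ring

theorem gamma_add_nat {b : ℂ} (hb : 0 < b.re) (n : ℕ) :
    Complex.Gamma (b + n) = Complex.Gamma b * (ascPochhammer ℂ n).eval b := by
  rw [← Complex.Gamma_add_nat_div_Gamma_eq b, mul_div_cancel₀]
  · exact Complex.Gamma_ne_zero_of_re_pos hb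
  · rintro k rfl
    simp at hb
    linarith [(Nat.cast_nonneg k : (0 : ℝ) ≤ k)]

theorem euler_eq {a b c : ℂ} (hb : 0 < b.re) (hcb : b.re < c.re) {z : ℂ}
    (hz : z ∈ Metric.ball (0 : ℂ) 1) :
    (∫ t : ℝ in (0 : ℝ)..1,
      ((t : ℂ) ^ (b - 1) * (1 - (t : ℂ)) ^ (c - b - 1)) * (1 - z * (t : ℂ)) ^ (-a))
    = Complex.Gamma b * Complex.Gamma (c - b) * Complex.regularizedGaussHGFun a b c z := by
  have hz1 : ‖z‖ < 1 := by simpa using hz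
  have hcb' : 0 < (c - b).re := by simpa using hcb
  have hconv : IntervalIntegrable (fun t : ℝ =>
      (t : ℂ) ^ (b - 1) * (1 - (t : ℂ)) ^ (c - b - 1)) MeasureTheory.volume 0 1 :=
    Complex.betaIntegral_convergent hb hcb'
  have hs := hasSum_one_sub_cpow a hz1
  have key : HasSum (fun n : ℕ => ∫ t : ℝ in (0 : ℝ)..1,
      ((t : ℂ) ^ (b - 1) * (1 - (t : ℂ)) ^ (c - b - 1)) *
        ((ascPochhammer ℂ n).eval a / n.factorial * (z * (t : ℂ)) ^ n))
      (∫ t : ℝ in (0 : ℝ)..1,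
      ((t : ℂ) ^ (b - 1) * (1 - (t : ℂ)) ^ (c - b - 1)) * (1 - z * (t : ℂ)) ^ (-a)) := by
    refine intervalIntegral.hasSum_integral_of_dominated_convergence
      (fun n t => ‖(t : ℂ) ^ (b - 1) * (1 - (t : ℂ)) ^ (c - b - 1)‖ *
        ‖(ascPochhammer ℂ n).eval a / n.factorial * z ^ n‖) ?_ ?_ ?_ ?_ ?_
    · intro n
      exact ((hconv.mul_continuousOn (by fun_prop)).def').aestronglyMeasurable
    · intro n
      refine Filter.Eventually.of_forall fun t ht => ?_
      rw [Set.uIoc_of_le zero_le_one] at ht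
      have h2 : ‖(t : ℂ)‖ ≤ 1 := by
        rw [Complex.norm_real, Real.norm_of_nonneg ht.1.le]; exact ht.2
      rw [norm_mul, mul_pow, ← mul_assoc, norm_mul _ ((t : ℂ) ^ n), norm_pow]
      gcongr
      exact mul_le_of_le_one_right (norm_nonneg _) (pow_le_one₀ (norm_nonneg _) h2)
    · exact Filter.Eventually.of_forall fun t _ => hs.summable.norm.mul_left _
    · simp_rw [tsum_mul_left]
      exact hconv.norm.mul_const _
    · refine Filter.Eventually.of_forall fun t ht => ?_
      rw [Set.uIoc_of_le zero_le_one] at ht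
      have h2 : ‖z * (t : ℂ)‖ < 1 := by
        rw [norm_mul, Complex.norm_real, Real.norm_of_nonneg ht.1.le]
        nlinarith [ht.1, ht.2, norm_nonneg z]
      exact (hasSum_one_sub_cpow a h2).mul_left _
  refine key.unique ?_
  refine hasSum_congr_fun ((hasSum_regularizedGaussHGFun a b c hz).mul_left
    (Complex.Gamma b * Complex.Gamma (c - b))) fun n => ?_
  symm
  have hbn : 0 < (b + n).re := by
    simp only [Complex.add_re, Complex.natCast_re]
    positivity
  have h3 := Complex.betaIntegral_eq_Gamma_mul_div (b + n) (c - b) hbn hcb'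
  have h4 : (b + n) + (c - b) = c + n := by ring
  rw [h4, gamma_add_nat hb, Complex.betaIntegral] at h3
  calc _ = ∫ t : ℝ in (0 : ℝ)..1, ((ascPochhammer ℂ n).eval a / n.factorial * z ^ n) *
        ((t : ℂ) ^ (b + n - 1) * (1 - (t : ℂ)) ^ (c - b - 1)) := by
        refine intervalIntegral.integral_congr_uIoo fun t ht => ?_
        rw [Set.uIoo_of_le zero_le_one] at ht
        have ht0 : (t : ℂ) ≠ 0 := by exact_mod_cast ht.1.ne'
        have h5 : b + n - 1 = b - 1 + n := by ring
        rw [h5, Complex.cpow_add _ _ ht0, Complex.cpow_natCast]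
        ring
    _ = _ := by
        rw [intervalIntegral.integral_const_mul, h3]
        ring

theorem mul_ascPochhammer_eval_add_one (b : ℂ) (n : ℕ) :
    b * (ascPochhammer ℂ n).eval (b + 1) = (ascPochhammer ℂ n).eval b * (b + n) := by
  rw [← ascPochhammer_succ_eval, ascPochhammer_succ_left]
  simp

theorem add_mul_eq_zero_of_hasSum {u v : ℕ → ℂ} {U V z : ℂ}
    (hu : HasSum (fun n => u n * z ^ n) U) (hv : HasSum (fun n => v n * z ^ n) V)
    (h0 : u 0 = 0) (h1 : ∀ n, u (n + 1) + v n = 0) : U + z * V = 0 := by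
  have h2 : HasSum (fun n => u (n + 1) * z ^ (n + 1)) U := by
    rw [hasSum_nat_add_iff (f := fun n => u n * z ^ n) 1]
    simpa [h0] using hu
  have h3 := h2.add (hv.mul_left z)
  refine h3.unique ?_
  convert hasSum_zero using 2 with n
  linear_combination z ^ (n + 1) * h1 n

theorem regularized_contiguous_c (a b c : ℂ) {z : ℂ} (hz : z ∈ Metric.ball (0 : ℂ) 1) :
    (1 - z) * Complex.regularizedGaussHGFun a b c z
      = (c - (2 * c - a - b + 1) * z) * Complex.regularizedGaussHGFun a b (c + 1) z
        + (c + 1 - a) * (c + 1 - b) * z * Complex.regularizedGaussHGFun a b (c + 2) z := by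
  have h := hasSum_regularizedGaussHGFun a b c hz
  have h1 := hasSum_regularizedGaussHGFun a b (c + 1) hz
  have h2 := hasSum_regularizedGaussHGFun a b (c + 2) hz
  have e := add_mul_eq_zero_of_hasSum
    (u := fun n => (ascPochhammer ℂ n).eval a * (ascPochhammer ℂ n).eval b
      / (n.factorial * Complex.Gamma (c + n)) - c * ((ascPochhammer ℂ n).eval a *
      (ascPochhammer ℂ n).eval b / (n.factorial * Complex.Gamma (c + 1 + n))))
    (v := fun n => -((ascPochhammer ℂ n).eval a * (ascPochhammer ℂ n).eval b
      / (n.factorial * Complex.Gamma (c + n))) + (2 * c - a - b + 1) * ((ascPochhammer ℂ n).eval a *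
      (ascPochhammer ℂ n).eval b / (n.factorial * Complex.Gamma (c + 1 + n)))
      - (c + 1 - a) * (c + 1 - b) * ((ascPochhammer ℂ n).eval a *
      (ascPochhammer ℂ n).eval b / (n.factorial * Complex.Gamma (c + 2 + n))))
    (z := z)
    (hasSum_congr_fun (h.sub (h1.mul_left c)) (fun n => by ring))
    (hasSum_congr_fun ((h.neg.add (h1.mul_left (2 * c - a - b + 1))).sub
      (h2.mul_left ((c + 1 - a) * (c + 1 - b)))) (fun n => by ring)) ?_ ?_
  · linear_combination e
  · have g := Complex.one_div_Gamma_eq_self_mul_one_div_Gamma_add_one c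
    simp [g]
  · intro n
    have g1 := Complex.one_div_Gamma_eq_self_mul_one_div_Gamma_add_one (c + n)
    have g2 := Complex.one_div_Gamma_eq_self_mul_one_div_Gamma_add_one (c + n + 1)
    have g3 := Complex.one_div_Gamma_eq_self_mul_one_div_Gamma_add_one (c + n + 1 + 1)
    have r1 : c + 1 + n = c + n + 1 := by ring
    have r2 : c + 2 + n = c + n + 1 + 1 := by ring
    have r3 : c + (n + 1 : ℕ) = c + n + 1 := by push_cast; ring
    have r4 : c + 1 + (n + 1 : ℕ) = c + n + 1 + 1 := by push_cast; ring
    have hn : (n : ℂ) + 1 ≠ 0 := by exact_mod_cast n.succ_ne_zero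
    have hf : (n.factorial : ℂ) ≠ 0 := by exact_mod_cast n.factorial_ne_zero
    rw [r1, r2, r3, r4]
    simp only [ascPochhammer_succ_eval, Nat.factorial_succ, div_eq_mul_inv, mul_inv, g1, g2]
    push_cast
    field_simp
    ring

theorem regularized_contiguous_b (a b c : ℂ) {z : ℂ} (hz : z ∈ Metric.ball (0 : ℂ) 1) :
    (c - b - 1) * Complex.regularizedGaussHGFun a b c z
      = - (2 * b + 2 - c + (a - b - 1) * z) * Complex.regularizedGaussHGFun a (b + 1) c z
        + (b + 1) * (1 - z) * Complex.regularizedGaussHGFun a (b + 2) c z := by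
  have h := hasSum_regularizedGaussHGFun a b c hz
  have h1 := hasSum_regularizedGaussHGFun a (b + 1) c hz
  have h2 := hasSum_regularizedGaussHGFun a (b + 2) c hz
  have e := add_mul_eq_zero_of_hasSum
    (u := fun n => (c - b - 1) * ((ascPochhammer ℂ n).eval a * (ascPochhammer ℂ n).eval b
      / (n.factorial * Complex.Gamma (c + n))) + (2 * b + 2 - c) * ((ascPochhammer ℂ n).eval a *
      (ascPochhammer ℂ n).eval (b + 1) / (n.factorial * Complex.Gamma (c + n)))
      - (b + 1) * ((ascPochhammer ℂ n).eval a *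
      (ascPochhammer ℂ n).eval (b + 2) / (n.factorial * Complex.Gamma (c + n))))
    (v := fun n => (a - b - 1) * ((ascPochhammer ℂ n).eval a *
      (ascPochhammer ℂ n).eval (b + 1) / (n.factorial * Complex.Gamma (c + n)))
      + (b + 1) * ((ascPochhammer ℂ n).eval a *
      (ascPochhammer ℂ n).eval (b + 2) / (n.factorial * Complex.Gamma (c + n))))
    (z := z)
    (hasSum_congr_fun (((h.mul_left (c - b - 1)).add (h1.mul_left (2 * b + 2 - c))).sub
      (h2.mul_left (b + 1))) (fun n => by ring))
    (hasSum_congr_fun ((h1.mul_left (a - b - 1)).add (h2.mul_left (b + 1))) (fun n => by ring)) ?_ ?_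
  · linear_combination e
  · simp
    ring
  · intro n
    have g1 := Complex.one_div_Gamma_eq_self_mul_one_div_Gamma_add_one (c + n)
    have r3 : c + (n + 1 : ℕ) = c + n + 1 := by push_cast; ring
    have p0 := mul_ascPochhammer_eval_add_one b n
    have p1 := mul_ascPochhammer_eval_add_one (b + 1) n
    have r4 : b + 1 + 1 = b + 2 := by ring
    rw [r4] at p1
    have hn : (n : ℂ) + 1 ≠ 0 := by exact_mod_cast n.succ_ne_zero
    have hf : (n.factorial : ℂ) ≠ 0 := by exact_mod_cast n.factorial_ne_zero
    rw [r3]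
    simp only [ascPochhammer_succ_eval, Nat.factorial_succ, div_eq_mul_inv, mul_inv, g1]
    push_cast
    rw [← p0]
    field_simp
    linear_combination (ascPochhammer ℂ n).eval a * (Complex.Gamma (c + n + 1))⁻¹ *
      (-(a + n) * (b + 2 + n) + (n + 1) * (c + n)) * p1

/-- The regularized Gauss series extends holomorphically to the cut plane. -/
def HasRegularizedContinuation (a b c : ℂ) : Prop :=
  ∃ g : ℂ → ℂ, DifferentiableOn ℂ g hypergeometricDomain ∧
    Set.EqOn g (Complex.regularizedGaussHGFun a b c) (Metric.ball 0 1)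

theorem hasRegularizedContinuation_base {a b c : ℂ} (hb : 0 < b.re) (hcb : b.re < c.re) : HasRegularizedContinuation a b c := by
  refine ⟨_, (differentiableOn_euler (a := a) hb hcb).const_mul
    (Complex.Gamma b * Complex.Gamma (c - b))⁻¹, fun z hz => ?_⟩
  rw [euler_eq hb hcb hz, inv_mul_cancel_left₀]
  exact mul_ne_zero (Complex.Gamma_ne_zero_of_re_pos hb)
    (Complex.Gamma_ne_zero_of_re_pos (by simpa using hcb))

theorem hasRegularizedContinuation_b (k : ℕ) : ∀ {a b c : ℂ}, -(k : ℝ) < b.re → b.re + 2 * k < c.re →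
    HasRegularizedContinuation a b c := by
  induction k with
  | zero => intro a b c h1 h2; exact hasRegularizedContinuation_base (by simpa using h1) (by simpa using h2)
  | succ k ih =>
    intro a b c h1 h2
    push_cast at h1 h2
    obtain ⟨g1, hg1, he1⟩ := ih (a := a) (b := b + 1) (c := c) (by simp; linarith)
      (by simp; linarith)
    obtain ⟨g2, hg2, he2⟩ := ih (a := a) (b := b + 2) (c := c) (by simp; linarith)
      (by simp; linarith)
    have hne : c - b - 1 ≠ 0 := by
      intro h
      have h3 := congrArg Complex.re h
      simp at h3
      linarith [(Nat.cast_nonneg k : (0 : ℝ) ≤ k)]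
    refine ⟨fun z => (c - b - 1)⁻¹ * (- (2 * b + 2 - c + (a - b - 1) * z) * g1 z
        + (b + 1) * (1 - z) * g2 z), by fun_prop, fun z hz => ?_⟩
    simp only
    rw [he1 hz, he2 hz, ← regularized_contiguous_b a b c hz, inv_mul_cancel_left₀ hne]

theorem hasRegularizedContinuation_c (a b : ℂ) (k : ℕ) : ∀ {c : ℂ}, -(k : ℝ) + b.re + 2 * ⌈|b.re| + 1⌉₊ < c.re →
    HasRegularizedContinuation a b c := by
  induction k with
  | zero =>
    intro c h
    have h1 := Nat.le_ceil (|b.re| + 1)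
    have h2 := neg_abs_le b.re
    refine hasRegularizedContinuation_b ⌈|b.re| + 1⌉₊ (by linarith) (by simpa using h)
  | succ k ih =>
    intro c h
    push_cast at h
    obtain ⟨g1, hg1, he1⟩ := ih (c := c + 1) (by simp; linarith)
    obtain ⟨g2, hg2, he2⟩ := ih (c := c + 2) (by simp; linarith)
    have hne : ∀ z ∈ hypergeometricDomain, 1 - z ≠ 0 := fun z hz =>
      Complex.slitPlane_ne_zero (mem_hypergeometricDomain_iff.1 hz)
    refine ⟨fun z => ((c - (2 * c - a - b + 1) * z) * g1 z
        + (c + 1 - a) * (c + 1 - b) * z * g2 z) / (1 - z),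
      DifferentiableOn.div (by fun_prop) (by fun_prop) hne, fun z hz => ?_⟩
    simp only
    rw [he1 hz, he2 hz, ← regularized_contiguous_c a b c hz,
      mul_div_cancel_left₀ _ (hne z (ball_subset_hypergeometricDomain hz))]

theorem hasRegularizedContinuation (a b c : ℂ) : HasRegularizedContinuation a b c := by
  obtain ⟨k, hk⟩ := exists_nat_gt (b.re + 2 * ⌈|b.re| + 1⌉₊ - c.re)
  exact hasRegularizedContinuation_c a b k (by linarith)

theorem exists_hypergeometric_continuation (a b c : ℂ) :
    ∃ g : ℂ → ℂ, DifferentiableOn ℂ g hypergeometricDomain ∧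
      Set.EqOn g (ordinaryHypergeometric a b c) (Metric.ball 0 1) := by
  by_cases hc : ∀ k : ℕ, c ≠ -k
  · obtain ⟨g, hg, he⟩ := hasRegularizedContinuation a b c
    refine ⟨fun z => Complex.Gamma c * g z, hg.const_mul _, fun z hz => ?_⟩
    simp only
    rw [he hz, ← Complex.ordinaryHypergeometric_div_Gamma_eq hc,
      mul_div_cancel₀ _ (Complex.Gamma_ne_zero hc)]
  · push Not at hc
    obtain ⟨k, rfl⟩ := hc
    refine ⟨ordinaryHypergeometric a b (-(k : ℂ)), fun z _ => ?_, fun z _ => rfl⟩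
    have hr : (ordinaryHypergeometricSeries ℂ a b (-(k : ℂ))).radius = ⊤ :=
      ordinaryHypergeometric_radius_top_of_neg_nat₃ ℂ a b
    have h := (ordinaryHypergeometricSeries ℂ a b (-(k : ℂ))).hasFPowerSeriesOnBall
      (by rw [hr]; exact ENNReal.zero_lt_top)
    rw [hr] at h
    exact (h.differentiableOn.differentiableAt (by simp)).differentiableWithinAt

/-- The Gauss hypergeometric function `F(a, b; c; z)`: the analytic continuation to `ℂ \ [1, ∞)` of
the sum of the hypergeometric series on the unit disc. Its values on the cut `[1, ∞)` carry no
meaning. -/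
noncomputable def gaussHypergeometric (a b c : ℂ) : ℂ → ℂ :=
  Classical.choose (exists_hypergeometric_continuation a b c)

theorem differentiableOn_gaussHypergeometric (a b c : ℂ) :
    DifferentiableOn ℂ (gaussHypergeometric a b c) hypergeometricDomain :=
  (Classical.choose_spec (exists_hypergeometric_continuation a b c)).1

theorem gaussHypergeometric_eq_series (a b c : ℂ) {z : ℂ} (hz : ‖z‖ < 1) :
    gaussHypergeometric a b c z = ordinaryHypergeometric a b c z :=
  (Classical.choose_spec (exists_hypergeometric_continuation a b c)).2 (by simpa using hz)

/-- The analytic continuation is unique. -/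
theorem gaussHypergeometric_unique {a b c : ℂ} {g : ℂ → ℂ}
    (hg : DifferentiableOn ℂ g hypergeometricDomain)
    (he : Set.EqOn g (ordinaryHypergeometric a b c) (Metric.ball 0 1)) :
    Set.EqOn g (gaussHypergeometric a b c) hypergeometricDomain := by
  have hU := isOpen_hypergeometricDomain
  have h0 : (0 : ℂ) ∈ hypergeometricDomain :=
    ball_subset_hypergeometricDomain (Metric.mem_ball_self one_pos)
  have hstar : StarConvex ℝ (0 : ℂ) hypergeometricDomain := by
    rw [starConvex_zero_iff]
    intro z hz t ht0 ht1
    have h := one_sub_mul_mem_slitPlane hz (t := t) ⟨ht0, ht1⟩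
    rw [mem_hypergeometricDomain_iff]
    simpa [mul_comm] using h
  refine (hg.analyticOnNhd hU).eqOn_of_preconnected_of_eventuallyEq
    ((differentiableOn_gaussHypergeometric a b c).analyticOnNhd hU)
    (hstar.isPathConnected h0).isConnected.isPreconnected h0 ?_
  filter_upwards [Metric.ball_mem_nhds (0 : ℂ) one_pos] with z hz
  rw [he hz, gaussHypergeometric_eq_series a b c (by simpa using hz)]

/-! With `s = x - y` the claim concerns `∫ F(a, b; c; x - s) s^(μ-1) / Γ(μ) ds` over `s > 0`. If `Re
b < Re c`, Euler's integral represents `F` by powers `(1 - (x - s)t)^(-a)`, and `1 - (x - s)t = A +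
ts` with `A = 1 - xt > 0`. After Fubini (`integrable_eulerWeylKernel`) the integral in `s` is of
beta type and equals `t^(-μ) A^(μ-a) B(μ, a-μ)` (`integral_cpow_mul_add_cpow`). What remains in `t`
is again an Euler integral, with `a, b, c` all lowered by `μ`; the difference `c - b` is unchanged.

For other `c` one inducts on `k` with `Re b < Re c + k`. The contiguous relation
`gaussHypergeometric_contiguous_lower` writes `F(a, b; c)` through `F(a, b; c+1)` and `z F(a+1, b+1;
c+2)`, and both have `Re (c - b)` larger by one. At `z = x - s` the factor `s` is absorbed by the
kernel, since `s · s^(μ-1) / Γ(μ) = μ s^μ / Γ(μ+1)`, so order `μ + 1` also occurs. The three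
resulting values recombine by the same contiguous relation at `a-μ, b-μ, c-μ`. -/

/-! ### Beta integrands and complex powers of positive reals -/

open MeasureTheory in
theorem integrableOn_betaIntegrand {u v : ℂ} (hu : 0 < u.re) (hv : 0 < v.re) :
    IntegrableOn (fun t : ℝ => (t : ℂ) ^ (u - 1) * (1 - (t : ℂ)) ^ (v - 1)) (Set.Ioo 0 1) :=
  ((intervalIntegrable_iff_integrableOn_Ioc_of_le zero_le_one).1
    (Complex.betaIntegral_convergent hu hv)).mono_set Set.Ioo_subset_Ioc_self

theorem intervalIntegral_zero_one_eq_integral_Ioo (f : ℝ → ℂ) :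
    ∫ t in (0 : ℝ)..1, f t = ∫ t in Set.Ioo (0 : ℝ) 1, f t := by
  rw [intervalIntegral.integral_of_le zero_le_one, MeasureTheory.integral_Ioc_eq_integral_Ioo]

/-- Turns identities between products of powers with positive bases into linear identities between
exponents. -/
theorem ofReal_cpow_eq_exp {r : ℝ} (hr : 0 < r) (w : ℂ) :
    (r : ℂ) ^ w = Complex.exp ((Real.log r : ℂ) * w) := by
  rw [Complex.cpow_def_of_ne_zero (by exact_mod_cast hr.ne'), Complex.ofReal_log hr.le]

/-! ### The substitution `u = ts / (A + ts)` from the half-line to the unit interval -/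

section MoebiusSubstitution

variable {A t : ℝ}

theorem hasDerivAt_mul_div_add_mul (hA : 0 < A) (ht : 0 < t) {s : ℝ} (hs : 0 < s) :
    HasDerivAt (fun s => t * s / (A + t * s)) (t * A / (A + t * s) ^ 2) s := by
  have hB : A + t * s ≠ 0 := by positivity
  have h1 : HasDerivAt (fun s => t * s) t s := by simpa using (hasDerivAt_id s).const_mul t
  exact (h1.div (h1.const_add A) hB).congr_deriv (by ring)

theorem injOn_mul_div_add_mul (hA : 0 < A) (ht : 0 < t) :
    Set.InjOn (fun s => t * s / (A + t * s)) (Set.Ioi 0) := by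
  intro s hs r hr h
  have hs' : 0 < s := hs
  have hr' : 0 < r := hr
  simp only at h
  rw [div_eq_div_iff (by positivity) (by positivity)] at h
  have : t * A * s = t * A * r := by linarith
  exact mul_left_cancel₀ (by positivity) this

theorem image_mul_div_add_mul (hA : 0 < A) (ht : 0 < t) :
    (fun s => t * s / (A + t * s)) '' Set.Ioi 0 = Set.Ioo 0 1 := by
  ext u
  constructor
  · rintro ⟨s, hs, rfl⟩
    have hs' : 0 < s := hs
    refine ⟨by positivity, ?_⟩
    simp only
    rw [div_lt_one (by positivity)]
    linarith
  · rintro ⟨h0, h1⟩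
    have h2 : 0 < 1 - u := by linarith
    -- The solution `s` of `u = ts / (A + ts)`.
    refine ⟨A * u / (t * (1 - u)), show 0 < A * u / (t * (1 - u)) by positivity, ?_⟩
    field_simp
    ring

/-- Here `1 - u = A / (A + ts)` and `du = tA / (A + ts)^2 ds`. Every base is positive, so after
taking logarithms it suffices to match the exponents of `t`, `A`, `s` and `A + ts`. -/
theorem abs_deriv_smul_betaIntegrand (hA : 0 < A) (ht : 0 < t) (μ a : ℂ) {s : ℝ} (hs : 0 < s) :
    |t * A / (A + t * s) ^ 2| • (((t * s / (A + t * s) : ℝ) : ℂ) ^ (μ - 1) *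
      (1 - ((t * s / (A + t * s) : ℝ) : ℂ)) ^ (a - μ - 1))
    = ((t : ℂ) ^ μ * (A : ℂ) ^ (a - μ)) * ((s : ℂ) ^ (μ - 1) * ((A + t * s : ℝ) : ℂ) ^ (-a)) := by
  have hB : 0 < A + t * s := by positivity
  have h1 : 1 - ((t * s / (A + t * s) : ℝ) : ℂ) = ((A / (A + t * s) : ℝ) : ℂ) := by
    rw [← Complex.ofReal_one, ← Complex.ofReal_sub]
    congr 1
    field_simp
    ring
  have h2 : ((t * A / (A + t * s) ^ 2 : ℝ) : ℂ) = Complex.exp (Real.log t + Real.log A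
      - 2 * Real.log (A + t * s)) := by
    rw [← Complex.cpow_one ((t * A / (A + t * s) ^ 2 : ℝ) : ℂ), ofReal_cpow_eq_exp (by positivity),
      Real.log_div (by positivity) (by positivity), Real.log_mul ht.ne' hA.ne', Real.log_pow]
    push_cast
    rw [mul_one]
  rw [abs_of_pos (by positivity), Complex.real_smul, h1, h2, ofReal_cpow_eq_exp (by positivity),
    ofReal_cpow_eq_exp (by positivity), ofReal_cpow_eq_exp ht, ofReal_cpow_eq_exp hA,
    ofReal_cpow_eq_exp hs, ofReal_cpow_eq_exp hB, Real.log_div (by positivity) hB.ne',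
    Real.log_mul ht.ne' hs.ne', Real.log_div hA.ne' hB.ne']
  simp only [← Complex.exp_add]
  congr 1
  push_cast
  ring

theorem integrableOn_cpow_mul_add_cpow (hA : 0 < A) (ht : 0 < t) {μ a : ℂ} (hμ : 0 < μ.re)
    (ha : μ.re < a.re) :
    MeasureTheory.IntegrableOn
      (fun s : ℝ => (s : ℂ) ^ (μ - 1) * ((A + t * s : ℝ) : ℂ) ^ (-a)) (Set.Ioi 0) := by
  have h := integrableOn_betaIntegrand hμ (v := a - μ) (by simpa using ha)
  rw [← image_mul_div_add_mul hA ht,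
    MeasureTheory.integrableOn_image_iff_integrableOn_abs_deriv_smul measurableSet_Ioi
    (fun s hs => (hasDerivAt_mul_div_add_mul hA ht hs).hasDerivWithinAt)
    (injOn_mul_div_add_mul hA ht)] at h
  have h2 := MeasureTheory.IntegrableOn.congr_fun h
    (fun s hs => abs_deriv_smul_betaIntegrand hA ht μ a hs) measurableSet_Ioi
  have h3 : (t : ℂ) ^ μ * (A : ℂ) ^ (a - μ) ≠ 0 := by
    rw [ofReal_cpow_eq_exp ht, ofReal_cpow_eq_exp hA]
    exact mul_ne_zero (Complex.exp_ne_zero _) (Complex.exp_ne_zero _)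
  exact (MeasureTheory.integrable_const_mul_iff (IsUnit.mk0 _ h3) _).1 h2

theorem cpow_mul_cpow_neg_cancel (hA : 0 < A) (ht : 0 < t) (μ a : ℂ) :
    ((t : ℂ) ^ (-μ) * (A : ℂ) ^ (μ - a)) * ((t : ℂ) ^ μ * (A : ℂ) ^ (a - μ)) = 1 := by
  simp only [ofReal_cpow_eq_exp ht, ofReal_cpow_eq_exp hA, ← Complex.exp_add]
  rw [Complex.exp_eq_one_iff]
  exact ⟨0, by push_cast; ring⟩

/-- No condition on `μ` or `a` is needed: the change of variables formula for the Bochner integral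
holds without integrability. -/
theorem integral_cpow_mul_add_cpow (hA : 0 < A) (ht : 0 < t) (μ a : ℂ) :
    ∫ s in Set.Ioi (0 : ℝ), (s : ℂ) ^ (μ - 1) * ((A + t * s : ℝ) : ℂ) ^ (-a)
      = (t : ℂ) ^ (-μ) * (A : ℂ) ^ (μ - a) * Complex.betaIntegral μ (a - μ) := by
  rw [Complex.betaIntegral, intervalIntegral_zero_one_eq_integral_Ioo,
    ← image_mul_div_add_mul hA ht,
    MeasureTheory.integral_image_eq_integral_abs_deriv_smul measurableSet_Ioi
    (fun s hs => (hasDerivAt_mul_div_add_mul hA ht hs).hasDerivWithinAt)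
    (injOn_mul_div_add_mul hA ht), MeasureTheory.setIntegral_congr_fun measurableSet_Ioi
    (fun s hs => abs_deriv_smul_betaIntegrand hA ht μ a hs), MeasureTheory.integral_const_mul,
    ← mul_assoc, cpow_mul_cpow_neg_cancel hA ht, one_mul]

/-- The same substitution for norms, as Tonelli requires. The last factor does not depend on `t` or
`A`, so the dependence on the slice is explicit. -/
theorem integral_norm_cpow_mul_add_cpow (hA : 0 < A) (ht : 0 < t) (μ a : ℂ) :
    ∫ s in Set.Ioi (0 : ℝ), ‖(s : ℂ) ^ (μ - 1) * ((A + t * s : ℝ) : ℂ) ^ (-a)‖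
      = ‖(t : ℂ) ^ (-μ) * (A : ℂ) ^ (μ - a)‖ *
        ∫ u in Set.Ioo (0 : ℝ) 1, ‖(u : ℂ) ^ (μ - 1) * (1 - (u : ℂ)) ^ (a - μ - 1)‖ := by
  have h : Set.EqOn (fun s : ℝ => |t * A / (A + t * s) ^ 2| • ‖((t * s / (A + t * s) : ℝ) : ℂ) ^
      (μ - 1) * (1 - ((t * s / (A + t * s) : ℝ) : ℂ)) ^ (a - μ - 1)‖)
      (fun s : ℝ => ‖(t : ℂ) ^ μ * (A : ℂ) ^ (a - μ)‖ *
        ‖(s : ℂ) ^ (μ - 1) * ((A + t * s : ℝ) : ℂ) ^ (-a)‖) (Set.Ioi 0) := fun s hs => by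
    have := congrArg norm (abs_deriv_smul_betaIntegrand hA ht μ a hs)
    rwa [norm_smul, Real.norm_eq_abs, abs_abs, norm_mul (_ * _) (_ * _)] at this
  rw [← image_mul_div_add_mul hA ht,
    MeasureTheory.integral_image_eq_integral_abs_deriv_smul measurableSet_Ioi
    (fun s hs => (hasDerivAt_mul_div_add_mul hA ht hs).hasDerivWithinAt)
    (injOn_mul_div_add_mul hA ht), MeasureTheory.setIntegral_congr_fun measurableSet_Ioi h,
    MeasureTheory.integral_const_mul, ← mul_assoc, ← norm_mul, cpow_mul_cpow_neg_cancel hA ht,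
    norm_one, one_mul]

end MoebiusSubstitution

/-! ### Euler's integral and a contiguous relation on the cut plane -/

/-- Both sides are holomorphic on the cut plane and agree on the unit disc by `euler_eq`, so
uniqueness of the continuation applies. -/
theorem gaussHypergeometric_eq_euler {a b c : ℂ} (hb : 0 < b.re) (hcb : b.re < c.re)
    {z : ℂ} (hz : z ∈ hypergeometricDomain) :
    gaussHypergeometric a b c z = Complex.Gamma c / (Complex.Gamma b * Complex.Gamma (c - b)) *
      ∫ t : ℝ in (0 : ℝ)..1,
        ((t : ℂ) ^ (b - 1) * (1 - (t : ℂ)) ^ (c - b - 1)) * (1 - z * (t : ℂ)) ^ (-a) := by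
  have hc : ∀ k : ℕ, c ≠ -(k : ℂ) := by
    rintro k rfl
    simp at hcb
    linarith [(Nat.cast_nonneg k : (0 : ℝ) ≤ k)]
  have hb0 := Complex.Gamma_ne_zero_of_re_pos hb
  have hcb0 := Complex.Gamma_ne_zero_of_re_pos (s := c - b) (by simpa using hcb)
  refine (gaussHypergeometric_unique (a := a) (b := b) (c := c)
    ((differentiableOn_euler (a := a) hb hcb).const_mul _) (fun w hw => ?_) hz).symm
  rw [euler_eq hb hcb hw, ← Complex.ordinaryHypergeometric_div_Gamma_eq hc]
  have := Complex.Gamma_ne_zero hc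
  field_simp

theorem add_one_ne_neg_natCast {c : ℂ} (hc : ∀ k : ℕ, c ≠ -(k : ℂ)) (k : ℕ) :
    c + 1 ≠ -(k : ℂ) := fun h => hc (k + 1) (by push_cast; linear_combination h)

/-- Comparison of coefficients: `1/Γ(c+n) = (c+n)/Γ(c+1+n)`, where `c` gives the first term and `n`
gives `z d/dz` of the series at `c + 1`. Differentiation raises all three parameters by one and
produces the factor `ab`. -/
theorem regularized_contiguous_lower (a b c : ℂ) {z : ℂ} (hz : z ∈ Metric.ball (0 : ℂ) 1) :
    Complex.regularizedGaussHGFun a b c z = c * Complex.regularizedGaussHGFun a b (c + 1) z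
      + a * b * z * Complex.regularizedGaussHGFun (a + 1) (b + 1) (c + 2) z := by
  have h := hasSum_regularizedGaussHGFun a b c hz
  have h1 := hasSum_regularizedGaussHGFun a b (c + 1) hz
  have h2 := hasSum_regularizedGaussHGFun (a + 1) (b + 1) (c + 2) hz
  have e := add_mul_eq_zero_of_hasSum
    (u := fun n => (ascPochhammer ℂ n).eval a * (ascPochhammer ℂ n).eval b
      / (n.factorial * Complex.Gamma (c + n)) - c * ((ascPochhammer ℂ n).eval a *
      (ascPochhammer ℂ n).eval b / (n.factorial * Complex.Gamma (c + 1 + n))))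
    (v := fun n => -(a * b * ((ascPochhammer ℂ n).eval (a + 1) * (ascPochhammer ℂ n).eval (b + 1)
      / (n.factorial * Complex.Gamma (c + 2 + n)))))
    (z := z)
    (hasSum_congr_fun (h.sub (h1.mul_left c)) (fun n => by ring))
    (hasSum_congr_fun (h2.mul_left (a * b)).neg (fun n => by ring)) ?_ ?_
  · linear_combination e
  · have g := Complex.one_div_Gamma_eq_self_mul_one_div_Gamma_add_one c
    simp [g]
  · intro n
    have g2 := Complex.one_div_Gamma_eq_self_mul_one_div_Gamma_add_one (c + n + 1)
    have r2 : c + 2 + n = c + n + 1 + 1 := by ring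
    have r3 : c + (n + 1 : ℕ) = c + n + 1 := by push_cast; ring
    have r4 : c + 1 + (n + 1 : ℕ) = c + n + 1 + 1 := by push_cast; ring
    have pa := mul_ascPochhammer_eval_add_one a n
    have pb := mul_ascPochhammer_eval_add_one b n
    have hn : (n : ℂ) + 1 ≠ 0 := by exact_mod_cast n.succ_ne_zero
    have hf : (n.factorial : ℂ) ≠ 0 := by exact_mod_cast n.factorial_ne_zero
    rw [r2, r3, r4]
    simp only [ascPochhammer_succ_eval, Nat.factorial_succ, div_eq_mul_inv, mul_inv, g2, ← pa, ← pb]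
    push_cast
    field_simp
    ring

/-- The contiguous relation that expresses `c F(a, b; c; z) = (c + z d/dz) F(a, b; c + 1; z)`. -/
theorem gaussHypergeometric_contiguous_lower {a b c : ℂ} (hc : ∀ k : ℕ, c ≠ -(k : ℂ)) {z : ℂ}
    (hz : z ∈ hypergeometricDomain) :
    gaussHypergeometric a b c z = gaussHypergeometric a b (c + 1) z
      + a * b / (c * (c + 1)) * (z * gaussHypergeometric (a + 1) (b + 1) (c + 2) z) := by
  have hc1 := add_one_ne_neg_natCast hc
  have hc2 := add_one_ne_neg_natCast hc1
  rw [add_assoc, one_add_one_eq_two] at hc2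
  have h0 : c ≠ 0 := by simpa using hc 0
  have h1 : c + 1 ≠ 0 := by simpa using hc1 0
  have d1 := differentiableOn_gaussHypergeometric a b (c + 1)
  have d2 := differentiableOn_gaussHypergeometric (a + 1) (b + 1) (c + 2)
  refine (gaussHypergeometric_unique (a := a) (b := b) (c := c)
    (g := fun z => gaussHypergeometric a b (c + 1) z
      + a * b / (c * (c + 1)) * (z * gaussHypergeometric (a + 1) (b + 1) (c + 2) z))
    (by fun_prop) (fun w hw => ?_) hz).symm
  have hw' : ‖w‖ < 1 := by simpa using hw
  have e := regularized_contiguous_lower a b c hw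
  rw [← Complex.ordinaryHypergeometric_div_Gamma_eq hc,
    ← Complex.ordinaryHypergeometric_div_Gamma_eq hc1,
    ← Complex.ordinaryHypergeometric_div_Gamma_eq hc2] at e
  simp only [gaussHypergeometric_eq_series _ _ _ hw']
  have g1 := Complex.Gamma_add_one c h0
  have g2 := Complex.Gamma_add_one (c + 1) h1
  rw [add_assoc, one_add_one_eq_two, g1] at g2
  rw [g1, g2] at e
  have := Complex.Gamma_ne_zero hc
  field_simp at e ⊢
  linear_combination -e

/-! ### The case `Re b < Re c` by Fubini -/

theorem one_sub_mul_pos {x t : ℝ} (hx : x < 1) (ht : t ∈ Set.Icc (0 : ℝ) 1) : 0 < 1 - x * t := by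
  rcases ht.1.eq_or_lt with h0 | h0
  · simp [← h0]
  · nlinarith [ht.2]

open MeasureTheory in
-- Tonelli with `t = p.2` fixed first: `0 < Re μ < Re a` makes the slices in `s` integrable, and `Re
-- μ < Re b < Re c` makes their norms integrable in `t`.
theorem integrable_eulerWeylKernel {a b c μ : ℂ} {x : ℝ} (hx : x < 1) (hμ : 0 < μ.re)
    (ha : μ.re < a.re) (hb : μ.re < b.re) (hcb : b.re < c.re) :
    Integrable (fun p : ℝ × ℝ => ((p.2 : ℂ) ^ (b - 1) * (1 - (p.2 : ℂ)) ^ (c - b - 1)) *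
      ((p.1 : ℂ) ^ (μ - 1) * ((1 - x * p.2 + p.2 * p.1 : ℝ) : ℂ) ^ (-a)))
      ((volume.restrict (Set.Ioi 0)).prod (volume.restrict (Set.Ioo 0 1))) := by
  have hA : ∀ t ∈ Set.Icc (0 : ℝ) 1, 0 < 1 - x * t := fun t ht => one_sub_mul_pos hx ht
  have hmeas : AEStronglyMeasurable (fun p : ℝ × ℝ => ((p.2 : ℂ) ^ (b - 1) *
      (1 - (p.2 : ℂ)) ^ (c - b - 1)) *
      ((p.1 : ℂ) ^ (μ - 1) * ((1 - x * p.2 + p.2 * p.1 : ℝ) : ℂ) ^ (-a)))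
      ((volume.restrict (Set.Ioi 0)).prod (volume.restrict (Set.Ioo 0 1))) := by
    rw [Measure.prod_restrict]
    refine ContinuousOn.aestronglyMeasurable ?_ (measurableSet_Ioi.prod measurableSet_Ioo)
    refine ((ContinuousOn.cpow (by fun_prop) (by fun_prop) ?_).mul
      (ContinuousOn.cpow (by fun_prop) (by fun_prop) ?_)).mul
      ((ContinuousOn.cpow (by fun_prop) (by fun_prop) ?_).mul
      (ContinuousOn.cpow (by fun_prop) (by fun_prop) ?_))
    · rintro ⟨s, t⟩ ⟨hs, ht⟩
      exact Complex.ofReal_mem_slitPlane.2 ht.1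
    · rintro ⟨s, t⟩ ⟨hs, ht⟩
      rw [← Complex.ofReal_one, ← Complex.ofReal_sub]
      exact Complex.ofReal_mem_slitPlane.2 (sub_pos.2 ht.2)
    · rintro ⟨s, t⟩ ⟨hs, ht⟩
      exact Complex.ofReal_mem_slitPlane.2 hs
    · rintro ⟨s, t⟩ ⟨hs, ht⟩
      exact Complex.ofReal_mem_slitPlane.2
        (add_pos (hA t (Set.Ioo_subset_Icc_self ht)) (mul_pos ht.1 hs))
  rw [integrable_prod_iff' hmeas]
  constructor
  · refine (ae_restrict_iff' measurableSet_Ioo).2 (Filter.Eventually.of_forall fun t ht => ?_)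
    exact (integrableOn_cpow_mul_add_cpow (hA t (Set.Ioo_subset_Icc_self ht)) ht.1 hμ ha).const_mul
      ((t : ℂ) ^ (b - 1) * (1 - (t : ℂ)) ^ (c - b - 1))
  -- The slice norm contributes `t^(-μ)`, which turns `t^(b-1)` into `t^(b-μ-1)`, and `(1 -
  -- xt)^(μ-a)`, which is continuous on `[0, 1]` because `x < 1`.
  · have h1 := (Complex.betaIntegral_convergent (u := b - μ) (v := c - b) (by simpa using hb)
      (by simpa using hcb)).mul_continuousOn
      (g := fun t : ℝ => ((1 - x * t : ℝ) : ℂ) ^ (μ - a)) (by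
        refine ContinuousOn.cpow (by fun_prop) (by fun_prop) fun t ht => ?_
        rw [Set.uIcc_of_le zero_le_one] at ht
        exact Complex.ofReal_mem_slitPlane.2 (hA t ht))
    have h2 := (((intervalIntegrable_iff_integrableOn_Ioc_of_le zero_le_one).1 h1).mono_set
      Set.Ioo_subset_Ioc_self).norm.mul_const
      (∫ u in Set.Ioo (0 : ℝ) 1, ‖(u : ℂ) ^ (μ - 1) * (1 - (u : ℂ)) ^ (a - μ - 1)‖)
    refine IntegrableOn.congr_fun h2 (fun t ht => ?_) measurableSet_Ioo
    have ht0 : (t : ℂ) ≠ 0 := by exact_mod_cast ht.1.ne'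
    simp only
    simp_rw [norm_mul (_ * (1 - (t : ℂ)) ^ (c - b - 1))]
    rw [integral_const_mul,
      integral_norm_cpow_mul_add_cpow (hA t (Set.Ioo_subset_Icc_self ht)) ht.1,
      ← mul_assoc, ← norm_mul, ← norm_mul]
    congr 2
    rw [show b - μ - 1 = (b - 1) + -μ by ring, Complex.cpow_add _ _ ht0]
    ring

open MeasureTheory in
theorem weylIntegral_gaussHypergeometric_of_re_lt {a b c μ : ℂ} {x : ℝ} (hx : x < 1)
    (hμ : 0 < μ.re) (ha : μ.re < a.re) (hb : μ.re < b.re) (hcb : b.re < c.re) :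
    IntegrableOn (fun s : ℝ => gaussHypergeometric a b c ((x - s : ℝ) : ℂ) *
      ((s : ℂ) ^ (μ - 1) / Complex.Gamma μ)) (Set.Ioi 0) ∧
    (∫ s in Set.Ioi (0 : ℝ), gaussHypergeometric a b c ((x - s : ℝ) : ℂ) *
      ((s : ℂ) ^ (μ - 1) / Complex.Gamma μ))
      = Complex.Gamma (a - μ) / Complex.Gamma a * (Complex.Gamma (b - μ) / Complex.Gamma b) *
        (Complex.Gamma c / Complex.Gamma (c - μ)) *
        gaussHypergeometric (a - μ) (b - μ) (c - μ) (x : ℂ) := by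
  have hA : ∀ t ∈ Set.Icc (0 : ℝ) 1, 0 < 1 - x * t := fun t ht => one_sub_mul_pos hx ht
  have hK := integrable_eulerWeylKernel hx hμ ha hb hcb
  set C : ℂ := Complex.Gamma c / (Complex.Gamma b * Complex.Gamma (c - b)) / Complex.Gamma μ
    with hC
  have hpt : Set.EqOn (fun s : ℝ => C * ∫ t in Set.Ioo (0 : ℝ) 1,
      ((t : ℂ) ^ (b - 1) * (1 - (t : ℂ)) ^ (c - b - 1)) *
      ((s : ℂ) ^ (μ - 1) * ((1 - x * t + t * s : ℝ) : ℂ) ^ (-a)))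
      (fun s : ℝ => gaussHypergeometric a b c ((x - s : ℝ) : ℂ) *
      ((s : ℂ) ^ (μ - 1) / Complex.Gamma μ)) (Set.Ioi 0) := fun s hs => by
    have hs' : 0 < s := hs
    simp only
    rw [gaussHypergeometric_eq_euler (hμ.trans hb) hcb
      (fun _ => by rw [Complex.ofReal_re]; linarith), intervalIntegral_zero_one_eq_integral_Ioo]
    have h1 : ∀ t : ℝ, ((t : ℂ) ^ (b - 1) * (1 - (t : ℂ)) ^ (c - b - 1)) *
      ((s : ℂ) ^ (μ - 1) * ((1 - x * t + t * s : ℝ) : ℂ) ^ (-a)) = (s : ℂ) ^ (μ - 1) *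
      (((t : ℂ) ^ (b - 1) * (1 - (t : ℂ)) ^ (c - b - 1)) *
        (1 - ((x - s : ℝ) : ℂ) * (t : ℂ)) ^ (-a)) := fun t => by
      rw [show 1 - ((x - s : ℝ) : ℂ) * (t : ℂ) = ((1 - x * t + t * s : ℝ) : ℂ) by push_cast; ring]
      ring
    simp_rw [h1]
    rw [integral_const_mul, hC]
    ring
  -- Absolute convergence is integrability of the marginal in `s` of the kernel.
  refine ⟨IntegrableOn.congr_fun (hK.integral_prod_left.const_mul C) hpt measurableSet_Ioi, ?_⟩
  rw [← setIntegral_congr_fun measurableSet_Ioi hpt, integral_const_mul,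
    integral_integral_swap (f := fun s t : ℝ => ((t : ℂ) ^ (b - 1) * (1 - (t : ℂ)) ^ (c - b - 1)) *
      ((s : ℂ) ^ (μ - 1) * ((1 - x * t + t * s : ℝ) : ℂ) ^ (-a))) hK]
  have hin : Set.EqOn (fun t : ℝ => ∫ s in Set.Ioi (0 : ℝ),
      ((t : ℂ) ^ (b - 1) * (1 - (t : ℂ)) ^ (c - b - 1)) *
      ((s : ℂ) ^ (μ - 1) * ((1 - x * t + t * s : ℝ) : ℂ) ^ (-a)))
      (fun t : ℝ => Complex.betaIntegral μ (a - μ) *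
        (((t : ℂ) ^ (b - μ - 1) * (1 - (t : ℂ)) ^ (c - μ - (b - μ) - 1)) *
        (1 - (x : ℂ) * (t : ℂ)) ^ (-(a - μ)))) (Set.Ioo 0 1) := fun t ht => by
    have ht0 : (t : ℂ) ≠ 0 := by exact_mod_cast ht.1.ne'
    simp only
    rw [integral_const_mul, integral_cpow_mul_add_cpow (hA t (Set.Ioo_subset_Icc_self ht)) ht.1,
      show b - μ - 1 = (b - 1) + -μ by ring, Complex.cpow_add _ _ ht0, neg_sub,
      show c - μ - (b - μ) - 1 = c - b - 1 by ring]
    push_cast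
    ring
  rw [setIntegral_congr_fun measurableSet_Ioo hin, integral_const_mul,
    gaussHypergeometric_eq_euler (a := a - μ) (b := b - μ) (c := c - μ) (by simpa using hb)
      (by simpa using hcb) (fun _ => by simpa using hx),
    intervalIntegral_zero_one_eq_integral_Ioo,
    Complex.betaIntegral_eq_Gamma_mul_div μ (a - μ) hμ (by simpa using ha), hC,
    show c - μ - (b - μ) = c - b by ring, show μ + (a - μ) = a by ring]
  have g1 := Complex.Gamma_ne_zero_of_re_pos hμ
  have g2 := Complex.Gamma_ne_zero_of_re_pos (s := b - μ) (by simpa using hb)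
  have g3 := Complex.Gamma_ne_zero_of_re_pos (s := c - μ) (by simpa using hb.trans hcb)
  -- Both sides contain the same Euler integral; only Gamma factors are left to cancel.
  generalize (∫ t in Set.Ioo (0 : ℝ) 1, _ : ℂ) = J
  field_simp

/-! ### General `c` by induction on the gap between `Re b` and `Re c` -/

open MeasureTheory in
-- All four parameters are quantified inside the induction, because the step also shifts `a`, `b`
-- and `μ`. Integrability belongs to the induction so that the integral may be split.
theorem weylIntegral_gaussHypergeometric {x : ℝ} (hx : x < 1) (k : ℕ) : ∀ {a b c μ : ℂ},
    0 < μ.re → μ.re < a.re → μ.re < b.re → (∀ n : ℕ, c ≠ -(n : ℂ)) →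
    (∀ n : ℕ, c - μ ≠ -(n : ℂ)) → b.re < c.re + k →
    IntegrableOn (fun s : ℝ => gaussHypergeometric a b c ((x - s : ℝ) : ℂ) *
      ((s : ℂ) ^ (μ - 1) / Complex.Gamma μ)) (Set.Ioi 0) ∧
    (∫ s in Set.Ioi (0 : ℝ), gaussHypergeometric a b c ((x - s : ℝ) : ℂ) *
      ((s : ℂ) ^ (μ - 1) / Complex.Gamma μ))
      = Complex.Gamma (a - μ) / Complex.Gamma a * (Complex.Gamma (b - μ) / Complex.Gamma b) *
        (Complex.Gamma c / Complex.Gamma (c - μ)) *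
        gaussHypergeometric (a - μ) (b - μ) (c - μ) (x : ℂ) := by
  induction k with
  | zero =>
    intro a b c μ hμ ha hb _ _ h
    exact weylIntegral_gaussHypergeometric_of_re_lt hx hμ ha hb (by simpa using h)
  | succ k ih =>
    intro a b c μ hμ ha hb hc hcμ h
    push_cast at h
    have hc1 := add_one_ne_neg_natCast hc
    have hc2 := add_one_ne_neg_natCast hc1
    have hcμ1 := add_one_ne_neg_natCast hcμ
    have hcμ2 := add_one_ne_neg_natCast hcμ1
    rw [add_assoc, one_add_one_eq_two] at hc2 hcμ2
    obtain ⟨i1, e1⟩ := ih (a := a) (b := b) (c := c + 1) (μ := μ) hμ ha hb hc1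
      (by rwa [add_sub_right_comm]) (by simp; linarith)
    obtain ⟨i2, e2⟩ := ih (a := a + 1) (b := b + 1) (c := c + 2) (μ := μ) hμ
      (by simp; linarith) (by simp; linarith) hc2 (by rwa [add_sub_right_comm]) (by simp; linarith)
    -- The term with the factor `s`, absorbed into order `μ + 1`. The differences `a - μ` and `b -
    -- μ` are unchanged, so this value involves the same function as `e1`.
    obtain ⟨i3, e3⟩ := ih (a := a + 1) (b := b + 1) (c := c + 2) (μ := μ + 1)
      (by simp; linarith) (by simp; linarith) (by simp; linarith) hc2
      (by rwa [show c + 2 - (μ + 1) = c - μ + 1 by ring]) (by simp; linarith)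
    have c0 : c ≠ 0 := by simpa using hc 0
    have c1 : c + 1 ≠ 0 := by simpa using hc1 0
    have d0 : c - μ ≠ 0 := by simpa using hcμ 0
    have d1 : c - μ + 1 ≠ 0 := by simpa using hcμ1 0
    have ne_zero : ∀ {w : ℂ}, 0 < w.re → w ≠ 0 := fun hw h0 => by simp [h0] at hw
    have μ0 := ne_zero hμ
    have a0 := ne_zero (hμ.trans ha)
    have b0 := ne_zero (hμ.trans hb)
    have aμ0 := ne_zero (w := a - μ) (by simpa using ha)
    have bμ0 := ne_zero (w := b - μ) (by simpa using hb)
    have ga := Complex.Gamma_ne_zero_of_re_pos (hμ.trans ha)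
    have gb := Complex.Gamma_ne_zero_of_re_pos (hμ.trans hb)
    have gμ := Complex.Gamma_ne_zero_of_re_pos hμ
    have gcμ := Complex.Gamma_ne_zero hcμ
    -- The contiguous relation at `z = x - s`, with `s · s^(μ-1) / Γ(μ)` rewritten as `μ s^μ /
    -- Γ(μ+1)`.
    have hpt : Set.EqOn (fun s : ℝ => gaussHypergeometric a b (c + 1) ((x - s : ℝ) : ℂ) *
        ((s : ℂ) ^ (μ - 1) / Complex.Gamma μ) + a * b / (c * (c + 1)) *
        (x * (gaussHypergeometric (a + 1) (b + 1) (c + 2) ((x - s : ℝ) : ℂ) *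
        ((s : ℂ) ^ (μ - 1) / Complex.Gamma μ)) -
        μ * (gaussHypergeometric (a + 1) (b + 1) (c + 2) ((x - s : ℝ) : ℂ) *
        ((s : ℂ) ^ (μ + 1 - 1) / Complex.Gamma (μ + 1)))))
        (fun s : ℝ => gaussHypergeometric a b c ((x - s : ℝ) : ℂ) *
        ((s : ℂ) ^ (μ - 1) / Complex.Gamma μ)) (Set.Ioi 0) := fun s hs => by
      have hs' : 0 < s := hs
      have hs0 : (s : ℂ) ≠ 0 := by exact_mod_cast hs'.ne'
      simp only
      rw [gaussHypergeometric_contiguous_lower (a := a) (b := b) hc (z := ((x - s : ℝ) : ℂ))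
        (fun _ => by rw [Complex.ofReal_re]; linarith), Complex.Gamma_add_one μ μ0,
        show μ + 1 - 1 = (μ - 1) + 1 by ring, Complex.cpow_add _ _ hs0, Complex.cpow_one]
      push_cast
      field_simp
    have i4 : IntegrableOn (fun s : ℝ =>
        x * (gaussHypergeometric (a + 1) (b + 1) (c + 2) ((x - s : ℝ) : ℂ) *
        ((s : ℂ) ^ (μ - 1) / Complex.Gamma μ)) -
        μ * (gaussHypergeometric (a + 1) (b + 1) (c + 2) ((x - s : ℝ) : ℂ) *
        ((s : ℂ) ^ (μ + 1 - 1) / Complex.Gamma (μ + 1)))) (Set.Ioi 0) := (i2.const_mul (x : ℂ)).sub (i3.const_mul μ)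
    refine ⟨IntegrableOn.congr_fun (i1.add (i4.const_mul _)) hpt measurableSet_Ioi, ?_⟩
    rw [← setIntegral_congr_fun measurableSet_Ioi hpt, integral_add i1 (i4.const_mul _),
      integral_const_mul, integral_sub (i2.const_mul (x : ℂ)) (i3.const_mul μ),
      integral_const_mul, integral_const_mul, e1, e2, e3,
      gaussHypergeometric_contiguous_lower (a := a - μ) (b := b - μ) hcμ (z := (x : ℂ))
        (fun _ => by simpa using hx),
      show a + 1 - (μ + 1) = a - μ by ring, show b + 1 - (μ + 1) = b - μ by ring,
      show c + 2 - (μ + 1) = c - μ + 1 by ring, show a + 1 - μ = a - μ + 1 by ring,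
      show b + 1 - μ = b - μ + 1 by ring, show c + 2 - μ = c - μ + 1 + 1 by ring,
      show c + 1 - μ = c - μ + 1 by ring, show c - μ + 2 = c - μ + 1 + 1 by ring,
      show c + 2 = c + 1 + 1 by ring, Complex.Gamma_add_one _ c1, Complex.Gamma_add_one _ c0,
      Complex.Gamma_add_one _ d1, Complex.Gamma_add_one _ d0, Complex.Gamma_add_one _ a0,
      Complex.Gamma_add_one _ b0, Complex.Gamma_add_one _ aμ0, Complex.Gamma_add_one _ bμ0]
    -- Only two function values survive. Relative to the target's Gamma factor, `F` gets `c/(c-μ)`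
    -- from `e1` and `-μ/(c-μ)` from `e3`, which add up to 1; `G` comes from `e2` alone.
    generalize gaussHypergeometric (a - μ) (b - μ) (c - μ + 1) (x : ℂ) = F
    generalize gaussHypergeometric (a - μ + 1) (b - μ + 1) (c - μ + 1 + 1) (x : ℂ) = G
    field_simp
    ring

/-! ### Return to the variable `y` by the reflection `s = x - y` -/

theorem mainTheorem1 (a b c μ : ℂ) (x : ℝ) (hx : x < 1) (hμ : 0 < μ.re)
    (ha : μ.re < a.re) (hb : μ.re < b.re)
    (hc : ∀ k : ℕ, c ≠ -(k : ℂ)) (hcμ : ∀ k : ℕ, c - μ ≠ -(k : ℂ)) :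
    MeasureTheory.IntegrableOn
      (fun y : ℝ => gaussHypergeometric a b c (y : ℂ) *
        (((x - y : ℝ) : ℂ) ^ (μ - 1) / Complex.Gamma μ))
      (Set.Iio x) MeasureTheory.volume ∧
    (∫ y in Set.Iio x, gaussHypergeometric a b c (y : ℂ) *
        (((x - y : ℝ) : ℂ) ^ (μ - 1) / Complex.Gamma μ))
      = Complex.Gamma (a - μ) / Complex.Gamma a * (Complex.Gamma (b - μ) / Complex.Gamma b) *
        (Complex.Gamma c / Complex.Gamma (c - μ)) *
        gaussHypergeometric (a - μ) (b - μ) (c - μ) (x : ℂ) := by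
  -- Any `k` above `Re b - Re c` gives enough induction steps.
  obtain ⟨k, hk⟩ := exists_nat_gt (b.re - c.re)
  obtain ⟨hi, he⟩ := weylIntegral_gaussHypergeometric hx k hμ ha hb hc hcμ (by linarith)
  have hm := MeasureTheory.Measure.measurePreserving_sub_left MeasureTheory.volume x
  have hme := (MeasurableEquiv.subLeft x).measurableEmbedding
  have hpre : (fun y : ℝ => x - y) ⁻¹' Set.Ioi 0 = Set.Iio x := by
    ext y
    simp
  have hf : (fun y : ℝ => gaussHypergeometric a b c (y : ℂ) *
      (((x - y : ℝ) : ℂ) ^ (μ - 1) / Complex.Gamma μ))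
      = (fun s : ℝ => gaussHypergeometric a b c ((x - s : ℝ) : ℂ) *
      ((s : ℂ) ^ (μ - 1) / Complex.Gamma μ)) ∘ (fun y => x - y) := by
    ext y
    simp [sub_sub_cancel]
  rw [hf, ← hpre, ← he]
  exact ⟨(hm.integrableOn_comp_preimage hme).2 hi, hm.setIntegral_preimage_emb hme
    (fun s : ℝ => gaussHypergeometric a b c ((x - s : ℝ) : ℂ) *
      ((s : ℂ) ^ (μ - 1) / Complex.Gamma μ)) _⟩
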